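/- Theorem. Let $\gamma \in (0,1]$. For a finite set $\mathcal N$ and $f\colon 2^{\mathcal N}\to\mathbb R$ write $f(u\mid A)=f(A\cup\{u\})-f(A)$. Call $f$ monotone if $f(A)\le f(B)$ whenever $A\subseteq B$; call $f$ $\gamma$-weakly DR if $f(u\mid A)\ge\gamma f(u\mid B)$ for all $A\subseteq B\subseteq\mathcal N$ and $u\in\mathcal N\setminus B$; call a monotone $f$ $\gamma$-weakly submodular if $\sum_{e\in B\setminus A} f(e\mid A)\ge\gamma\,(f(A\cup B)-f(A))$ for all $A\subseteq B\subseteq\mathcal N$. Consider the problem $\max\{f(S) : S\subseteq\mathcal N,\ |S|\le k\}$ in the value oracle model: the algorithm knows $\mathcal N$ and the integer $k\ge 0$, and it accesses $f$ only by evaluating $f(S)$ (exactly, as a real number) at adaptively chosen sets $S\subseteq \mathcal N$; its running time is the number of function evaluations it makes, all other computation being free. A (randomized) algorithm is a random deterministic algorithm for every pair $(n,k)$, where $n=|\mathcal N|$. For a given class of functions $f$, it is polynomial-time if there is a polynomial $p$ such that, for all $n$, all $k$, all $f$ in the class and all random seeds, it makes at most $p(n)$ evaluations. It achieves a $\rho$-approximation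 if, for all $n$, $k$ and $f$ in the class, it always outputs a set $R$ with $|R|\le k$, and $\mathbb E[f(R)]\ge\rho\cdot\max_{|S|\le k} f(S)$. Then: 1. For every $\varepsilon>0$, no polynomial-time algorithm achieves a $(1-e^{-\gamma}+\varepsilon)$-approximation for the class of non-negative monotone $\gamma$-weakly DR functions. 2. For every $\varepsilon>0$, no polynomial-time algorithm achieves a $(1-e^{-\gamma}+\varepsilon)$-approximation for the class of non-negative monotone $\gamma$-weakly submodular functions. 3. These bounds are tight: for each of the two classes there is a polynomial-time algorithm that achieves a $(1-e^{-\gamma})$-approximation. -/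

import Mathlib

open MeasureTheory

universe u

/-- The marginal gain `f(u ∣ A) = f(A ∪ {u}) - f(A)`. -/
def marginalGain {V : Type*} [DecidableEq V] (f : Finset V → ℝ) (u : V) (A : Finset V) : ℝ :=
  f (insert u A) - f A

/-- `f` is `γ`-weakly DR: `f(u ∣ A) ≥ γ · f(u ∣ B)` for all `A ⊆ B` and `u ∉ B`. -/
def IsWeaklyDR {V : Type*} [DecidableEq V] (γ : ℝ) (f : Finset V → ℝ) : Prop :=
  ∀ A B : Finset V, A ⊆ B → ∀ u : V, u ∉ B → marginalGain f u A ≥ γ * marginalGain f u B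

/-- The inequality that makes a monotone set function `γ`-weakly submodular. -/
def IsWeaklySubmodular {V : Type*} [DecidableEq V] (γ : ℝ) (f : Finset V → ℝ) : Prop :=
  ∀ A B : Finset V, A ⊆ B → ∑ e ∈ B \ A, marginalGain f e A ≥ γ * (f (A ∪ B) - f A)

/-- A class of objective functions: for every `n`, a set of set functions on the ground set
`{0, …, n - 1}`. Together with a cardinality bound `k`, a member is an instance of the problem
`max {f S ∣ |S| ≤ k}`. -/
abbrev ObjectiveClass : Type := ∀ n : ℕ, Set (Finset (Fin n) → ℝ)

/-- The non-negative monotone `γ`-weakly DR functions. -/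
def weaklyDRClass (γ : ℝ) : ObjectiveClass := fun _ =>
  {f | (∀ S, 0 ≤ f S) ∧ Monotone f ∧ IsWeaklyDR γ f}

/-- The non-negative monotone `γ`-weakly submodular functions. -/
def weaklySubmodularClass (γ : ℝ) : ObjectiveClass := fun _ =>
  {f | (∀ S, 0 ≤ f S) ∧ Monotone f ∧ IsWeaklySubmodular γ f}

/-- A deterministic algorithm in the value oracle model on the ground set `V`. It either stops and
outputs a set, or evaluates the objective at a set and continues in a way that may depend
arbitrarily on the (exact, real) value returned. The objective is accessible in no other way. -/
inductive OracleAlgorithm (V : Type) : Type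
  | output (S : Finset V) : OracleAlgorithm V
  | query (S : Finset V) (next : ℝ → OracleAlgorithm V) : OracleAlgorithm V

namespace OracleAlgorithm

/-- The set that the algorithm outputs when the value oracle is `f`. -/
def result {V : Type} (f : Finset V → ℝ) : OracleAlgorithm V → Finset V
  | output S => S
  | query S next => result f (next (f S))

/-- The running time in the value oracle model: the number of function evaluations made when the
value oracle is `f`. -/
def queries {V : Type} (f : Finset V → ℝ) : OracleAlgorithm V → ℕ
  | output _ => 0
  | query S next => queries f (next (f S)) + 1

end OracleAlgorithm

/-- A (randomized) algorithm in the value oracle model: a random deterministic algorithm for each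
size `n` of the ground set and each cardinality bound `k`. The random seed comes from an arbitrary
probability space, and on every fixed input the output is a random variable. -/
structure RandomizedAlgorithm where
  /-- The set of random seeds. -/
  Seed : Type u
  [measurableSpace : MeasurableSpace Seed]
  /-- The law of the random seed. -/
  law : Measure Seed
  [isProbabilityMeasure : IsProbabilityMeasure law]
  /-- The deterministic algorithm used for a given seed, on input `n` and `k`. -/
  run (n k : ℕ) : Seed → OracleAlgorithm (Fin n)
  measurableSet_result (n k : ℕ) (f : Finset (Fin n) → ℝ) (S : Finset (Fin n)) :
    MeasurableSet {ω | (run n k ω).result f = S}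

attribute [instance] RandomizedAlgorithm.measurableSpace RandomizedAlgorithm.isProbabilityMeasure

namespace RandomizedAlgorithm

/-- On all instances with objective in `C`, and for all random seeds, the running time (number of
function evaluations) is at most a fixed polynomial in the size `n` of the ground set. -/
def IsPolynomialTime (A : RandomizedAlgorithm) (C : ObjectiveClass) : Prop :=
  ∃ p : Polynomial ℕ, ∀ (n k : ℕ), ∀ f ∈ C n, ∀ ω, (A.run n k ω).queries f ≤ p.eval n

/-- On all instances `max {f S ∣ |S| ≤ k}` with `f ∈ C`, the output is always feasible and its
expected value is at least `ρ` times the value of every feasible set. -/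
def IsApproximation (A : RandomizedAlgorithm) (C : ObjectiveClass) (ρ : ℝ) : Prop :=
  ∀ (n k : ℕ), ∀ f ∈ C n,
    (∀ ω, ((A.run n k ω).result f).card ≤ k) ∧
    ∀ S : Finset (Fin n), S.card ≤ k → ρ * f S ≤ ∫ ω, f ((A.run n k ω).result f) ∂A.law

end RandomizedAlgorithm

/-- Some polynomial-time algorithm in the value oracle model achieves a `ρ`-approximation for
maximizing a function of the class `C` under a cardinality constraint. -/
def HasPolynomialTimeApproximation (C : ObjectiveClass) (ρ : ℝ) : Prop :=
  ∃ A : RandomizedAlgorithm.{u}, A.IsPolynomialTime C ∧ A.IsApproximation C ρ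

/-!
The greedy algorithm achieves the ratio `1 - e ^ (-γ)`, and no ratio above it is achievable because
an optimal solution can be hidden from every algorithm that evaluates polynomially many sets.

*Greedy.* A weakly DR function is weakly submodular with the same constant
(`IsWeaklyDR.isWeaklySubmodular`), so the guarantee is needed for weakly submodular functions only,
and hardness for weakly DR functions only. If `|O| ≤ k`, then the marginal gains of the elements of
`O` at the current set `A` sum to at least `γ (f O - f A)`. The best of them is at least a `k`-th of
this, so that each step multiplies the distance to `f O` by at most `1 - γ / k`
(`OracleAlgorithm.sub_bestExtension_le`), and `(1 - γ / k) ^ k ≤ e ^ (-γ)`.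

*Hardness.* Put `q = 1 - γ / k`. Up to a truncation at `1 - η`, the hard objective that conceals a
set `T` of size `k` is `1 - w (|S ∩ T|) * q ^ |S \ T|` (`concealingObjective`). Here `w a = q ^ a` for
`a ≤ t`, so that elements of `T` first look like all others, with gain `γ / k` times the remaining
distance. From then on `w` decreases linearly by `q ^ t / k` per element. This is faster by a factor
of about `1 / γ`, which is exactly what the weak DR property permits
(`isWeaklyDR_one_sub_concealedGap`), and it makes `T` nearly optimal: its value is `1 - η` as soon as
`t / k ≤ η`. A set that meets `T` in at most `t` elements has a value depending on its size only, and
so has a set of at least `(l + 1) k` elements, for a constant `l` depending on `γ` and `η`, because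
there the truncation takes effect. An output of size at most `k` that meets `T` in at most `t`
elements has value at most `1 - q ^ k`, which is close to `1 - e ^ (-γ)`.

For `n = k ^ 3`, the concealed set is a random transversal of `k` blocks of size `k ^ 2`. A fixed set
of `O(k)` elements meets it in more than `t` elements with probability `O(k ^ (-t - 1))`, by Markov's
inequality for the generating function of the size of the intersection
(`card_filter_lt_card_inter_transversal_le`). If `t` is at least the degree in `k` of the number of
queries, then by a union bound the algorithm runs with high probability as it does on the objective
that conceals the empty set, and its output is poor (`sum_concealingObjective_result_le`). Averaging
over the transversals instead of the seeds and letting `k → ∞`, then `η → 0`, gives the bound.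
-/

/-! ### Weakly DR functions are weakly submodular -/

open Finset in
/-- The gain of adding `D` telescopes into gains of single elements at sets containing `A`, and `γ`
times each of them is at most the gain of the same element at `A`. -/
theorem IsWeaklyDR.mul_union_sub_le {V : Type*} [DecidableEq V] {γ : ℝ} {f : Finset V → ℝ}
    (hf : IsWeaklyDR γ f) (A D : Finset V) (hD : Disjoint A D) :
    γ * (f (A ∪ D) - f A) ≤ ∑ e ∈ D, marginalGain f e A := by
  induction D using Finset.induction_on with
  | empty => simp
  | insert x D hx ih =>
    have hxA : x ∉ A := fun h => (Finset.disjoint_left.1 hD h) (mem_insert_self x D)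
    have hD' : Disjoint A D := hD.mono_right (subset_insert x D)
    have h := hf A (A ∪ D) subset_union_left x (by simp [hx, hxA])
    rw [sum_insert hx, union_insert]
    have e : marginalGain f x (A ∪ D) = f (insert x (A ∪ D)) - f (A ∪ D) := rfl
    rw [e] at h
    linarith [ih hD', h]

theorem IsWeaklyDR.isWeaklySubmodular {V : Type*} [DecidableEq V] {γ : ℝ} {f : Finset V → ℝ}
    (hf : IsWeaklyDR γ f) : IsWeaklySubmodular γ f := by
  intro A B hAB
  have h := hf.mul_union_sub_le A (B \ A) Finset.disjoint_sdiff
  rwa [Finset.union_sdiff_self_eq_union] at h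

theorem weaklyDRClass_subset (γ : ℝ) (n : ℕ) : weaklyDRClass γ n ⊆ weaklySubmodularClass γ n :=
  fun _ hf => ⟨hf.1, hf.2.1, hf.2.2.isWeaklySubmodular⟩

/-- A guarantee for a class of objectives is inherited by every smaller class. -/
theorem HasPolynomialTimeApproximation.mono {C D : ObjectiveClass} (h : ∀ n, C n ⊆ D n) {ρ : ℝ}
    (hD : HasPolynomialTimeApproximation.{u} D ρ) : HasPolynomialTimeApproximation.{u} C ρ := by
  obtain ⟨A, ⟨p, hp⟩, hA⟩ := hD
  exact ⟨A, ⟨p, fun n k f hf => hp n k f (h n hf)⟩, fun n k f hf => hA n k f (h n hf)⟩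

/-! ### The greedy algorithm -/

namespace OracleAlgorithm

variable {V : Type} [DecidableEq V]

/-- Evaluate the objective at all sets of a list, and continue with the table of the values read
(which is `0` away from the list). -/
def tabulate : List (Finset V) → ((Finset V → ℝ) → OracleAlgorithm V) → OracleAlgorithm V
  | [], c => c 0
  | S :: L, c => query S fun r => tabulate L fun h => c (Function.update h S r)

/-- The table of values that `tabulate` hands on. -/
def table (f : Finset V → ℝ) : List (Finset V) → Finset V → ℝ
  | [] => 0
  | S :: L => Function.update (table f L) S (f S)

theorem table_apply (f : Finset V → ℝ) {L : List (Finset V)} {S : Finset V} (hS : S ∈ L) :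
    table f L S = f S := by
  induction L with
  | nil => simp at hS
  | cons S' L ih =>
    by_cases h : S = S'
    · subst h; simp [table]
    · rw [table, Function.update_of_ne h]
      exact ih ((List.mem_cons.1 hS).resolve_left h)

theorem result_tabulate (f : Finset V → ℝ) (L : List (Finset V))
    (c : (Finset V → ℝ) → OracleAlgorithm V) :
    (tabulate L c).result f = (c (table f L)).result f := by
  induction L generalizing c with
  | nil => rfl
  | cons S L ih => simp only [tabulate, result, ih]; rfl

theorem queries_tabulate (f : Finset V → ℝ) (L : List (Finset V))
    (c : (Finset V → ℝ) → OracleAlgorithm V) :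
    (tabulate L c).queries f = L.length + (c (table f L)).queries f := by
  induction L generalizing c with
  | nil => simp [tabulate, table]
  | cons S L ih =>
    simp only [tabulate, queries, ih, List.length_cons, table]
    omega

variable [Fintype V]

/-- The sets obtained from `A` by adding at most one element. -/
def extensions (A : Finset V) : Finset (Finset V) :=
  insert A (Finset.univ.image fun e => insert e A)

theorem extensions_nonempty (A : Finset V) : (extensions A).Nonempty :=
  Finset.insert_nonempty _ _

/-- An extension of `A` by at most one element on which the table `h` is largest. -/
noncomputable def bestExtension (h : Finset V → ℝ) (A : Finset V) : Finset V :=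
  ((extensions A).exists_max_image h (extensions_nonempty A)).choose

theorem bestExtension_mem (h : Finset V → ℝ) (A : Finset V) : bestExtension h A ∈ extensions A :=
  ((extensions A).exists_max_image h (extensions_nonempty A)).choose_spec.1

theorem le_bestExtension (h : Finset V → ℝ) (A : Finset V) {S : Finset V}
    (hS : S ∈ extensions A) : h S ≤ h (bestExtension h A) :=
  ((extensions A).exists_max_image h (extensions_nonempty A)).choose_spec.2 S hS

theorem card_bestExtension_le (h : Finset V → ℝ) (A : Finset V) :
    (bestExtension h A).card ≤ A.card + 1 := by
  have := bestExtension_mem h A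
  simp only [extensions, Finset.mem_insert, Finset.mem_image, Finset.mem_univ, true_and] at this
  rcases this with h' | ⟨e, h'⟩
  · rw [h']; omega
  · rw [← h']; exact Finset.card_insert_le _ _

/-- The greedy algorithm, which extends `A` by the best single element for the given number of
rounds. -/
noncomputable def greedy : ℕ → Finset V → OracleAlgorithm V
  | 0, A => output A
  | j + 1, A => tabulate (extensions A).toList fun h => greedy j (bestExtension h A)

theorem card_result_greedy_le (f : Finset V → ℝ) (j : ℕ) (A : Finset V) :
    ((greedy j A).result f).card ≤ A.card + j := by
  induction j generalizing A with
  | zero => simp [greedy, result]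
  | succ j ih =>
    rw [greedy, result_tabulate]
    refine (ih _).trans ?_
    have := card_bestExtension_le (table f (extensions A).toList) A
    omega

theorem queries_greedy_le (f : Finset V → ℝ) (j : ℕ) (A : Finset V) :
    (greedy j A).queries f ≤ j * (Fintype.card V + 1) := by
  induction j generalizing A with
  | zero => simp [greedy, queries]
  | succ j ih =>
    rw [greedy, queries_tabulate, Finset.length_toList]
    have h1 : (extensions A).card ≤ Fintype.card V + 1 :=
      (Finset.card_insert_le _ _).trans (Nat.succ_le_succ Finset.card_image_le)
    have h2 := ih (bestExtension (table f (extensions A).toList) A)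
    rw [Nat.succ_mul]
    omega

/-- One greedy step closes a `γ / k` fraction of the gap to any set `O` of at most `k` elements:
the marginal gains of the elements of `O` sum to at least `γ` times the gap, and the best one is at
least their average. -/
theorem sub_bestExtension_le {γ : ℝ} (hγ : 0 ≤ γ) {f : Finset V → ℝ} (hm : Monotone f)
    (hf : IsWeaklySubmodular γ f) {k : ℕ} (hk : 0 < k) {O : Finset V} (hO : O.card ≤ k)
    (A : Finset V) :
    f O - f (bestExtension (table f (extensions A).toList) A) ≤ (1 - γ / k) * (f O - f A) := by
  set M := bestExtension (table f (extensions A).toList) A with hM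
  have key : ∀ S ∈ extensions A, f S ≤ f M := by
    intro S hS
    have h := le_bestExtension (table f (extensions A).toList) A hS
    rwa [table_apply f (Finset.mem_toList.2 hS),
      table_apply f (Finset.mem_toList.2 (bestExtension_mem _ A))] at h
  have hAM : f A ≤ f M := key A (Finset.mem_insert_self _ _)
  have h1 := hf A (A ∪ O) Finset.subset_union_left
  have h2 : ∑ e ∈ (A ∪ O) \ A, marginalGain f e A ≤ k * (f M - f A) := by
    calc ∑ e ∈ (A ∪ O) \ A, marginalGain f e A
        ≤ ∑ _e ∈ (A ∪ O) \ A, (f M - f A) := by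
          refine Finset.sum_le_sum fun e _ => ?_
          refine sub_le_sub_right (key _ ?_) _
          exact Finset.mem_insert_of_mem (Finset.mem_image_of_mem _ (Finset.mem_univ e))
      _ = (((A ∪ O) \ A).card : ℝ) * (f M - f A) := by rw [Finset.sum_const, nsmul_eq_mul]
      _ ≤ k * (f M - f A) := by
          refine mul_le_mul_of_nonneg_right ?_ (sub_nonneg.2 hAM)
          have : ((A ∪ O) \ A).card ≤ k := by
            rw [Finset.union_sdiff_left]
            exact (Finset.card_le_card Finset.sdiff_subset).trans hO
          exact_mod_cast this
  have h3 : f O ≤ f (A ∪ (A ∪ O)) :=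
    hm (Finset.subset_union_right.trans Finset.subset_union_right)
  have h4 : γ * (f O - f A) ≤ k * (f M - f A) := by
    have := mul_le_mul_of_nonneg_left (sub_le_sub_right h3 (f A)) hγ
    linarith
  have hk' : (0 : ℝ) < k := by exact_mod_cast hk
  have h5 : γ / k * (f O - f A) ≤ f M - f A := by
    rw [div_mul_eq_mul_div, div_le_iff₀ hk']
    linarith
  linarith

theorem sub_result_greedy_le {γ : ℝ} (hγ0 : 0 ≤ γ) (hγ1 : γ ≤ 1) {f : Finset V → ℝ}
    (hm : Monotone f) (hf : IsWeaklySubmodular γ f) {k : ℕ} (hk : 0 < k) {O : Finset V}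
    (hO : O.card ≤ k) (j : ℕ) (A : Finset V) :
    f O - f ((greedy j A).result f) ≤ (1 - γ / k) ^ j * (f O - f A) := by
  have hq : 0 ≤ 1 - γ / k := by
    have : γ / k ≤ 1 := div_le_one_of_le₀ (hγ1.trans (by exact_mod_cast hk)) (by positivity)
    linarith
  induction j generalizing A with
  | zero => simp [greedy, result]
  | succ j ih =>
    rw [greedy, result_tabulate, pow_succ, mul_assoc]
    exact (ih _).trans (mul_le_mul_of_nonneg_left
      (sub_bestExtension_le hγ0 hm hf hk hO A) (pow_nonneg hq j))

end OracleAlgorithm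

open OracleAlgorithm in
/-- The greedy algorithm as a randomized algorithm with a single seed. For `k ≥ n` it outputs the
whole ground set, which keeps the number of rounds below `n`. -/
noncomputable def greedyAlgorithm : RandomizedAlgorithm.{u} where
  Seed := PUnit
  law := Measure.dirac PUnit.unit
  run n k _ := if n ≤ k then output Finset.univ else greedy k ∅
  measurableSet_result _ _ _ _ := MeasurableSet.of_discrete

theorem greedyAlgorithm_isPolynomialTime (C : ObjectiveClass) :
    greedyAlgorithm.{u}.IsPolynomialTime C := by
  refine ⟨Polynomial.X * (Polynomial.X + 1), fun n k f _ ω => ?_⟩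
  simp only [greedyAlgorithm, Polynomial.eval_mul, Polynomial.eval_X, Polynomial.eval_add,
    Polynomial.eval_one]
  split_ifs with h
  · simp [OracleAlgorithm.queries]
  · refine (OracleAlgorithm.queries_greedy_le f k ∅).trans ?_
    rw [Fintype.card_fin]
    exact Nat.mul_le_mul_right _ (not_le.1 h).le

theorem greedyAlgorithm_isApproximation {γ : ℝ} (hγ0 : 0 < γ) (hγ1 : γ ≤ 1) :
    greedyAlgorithm.{u}.IsApproximation (weaklySubmodularClass γ) (1 - Real.exp (-γ)) := by
  rintro n k f ⟨h0, hm, hf⟩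
  have he : 0 < Real.exp (-γ) := Real.exp_pos _
  -- Any set at least as good as `S` meets the guarantee, since the ratio is at most `1`.
  have htriv : ∀ S R : Finset (Fin n), f S ≤ f R → (1 - Real.exp (-γ)) * f S ≤ f R := by
    intro S R h
    nlinarith [h0 S]
  refine ⟨fun ω => ?_, fun S hS => ?_⟩
  · simp only [greedyAlgorithm]
    split_ifs with h
    · simpa [OracleAlgorithm.result] using h
    · simpa using OracleAlgorithm.card_result_greedy_le f k ∅
  · change _ ≤ ∫ ω, f ((greedyAlgorithm.run n k ω).result f) ∂(Measure.dirac PUnit.unit)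
    rw [integral_dirac]
    simp only [greedyAlgorithm]
    split_ifs with h
    · exact htriv _ _ (hm (Finset.subset_univ S))
    · rcases Nat.eq_zero_or_pos k with rfl | hk
      · exact htriv _ _ (hm (by simp [Finset.card_eq_zero.1 (Nat.le_zero.1 hS)]))
      · have h1 := OracleAlgorithm.sub_result_greedy_le hγ0.le hγ1 hm hf hk hS k ∅
        have hk' : γ ≤ k := hγ1.trans (by exact_mod_cast hk)
        have h2 : (1 - γ / k) ^ k ≤ Real.exp (-γ) := Real.one_sub_div_pow_le_exp_neg hk'
        have hq : 0 ≤ (1 - γ / k : ℝ) := by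
          have : γ / k ≤ 1 := div_le_one_of_le₀ hk' (by positivity)
          linarith
        have h3 : (1 - γ / k) ^ k * (f S - f ∅) ≤ Real.exp (-γ) * f S :=
          mul_le_mul h2 (by linarith [h0 ∅]) (sub_nonneg.2 (hm (Finset.empty_subset S))) he.le
        linarith

/-! ### Objectives that conceal a set -/

/-- Truncating a monotone function from above preserves the weak DR property. -/
theorem IsWeaklyDR.min_const {V : Type*} [DecidableEq V] {γ : ℝ} (hγ0 : 0 ≤ γ) (hγ1 : γ ≤ 1)
    {f : Finset V → ℝ} (hf : IsWeaklyDR γ f) (hm : Monotone f) (c : ℝ) :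
    IsWeaklyDR γ fun S => min (f S) c := by
  intro A B hAB u hu
  have h := hf A B hAB u hu
  have h1 := hm hAB
  have h2 := hm (Finset.subset_insert u B)
  have h3 := hm (Finset.subset_insert u A)
  simp only [marginalGain, ge_iff_le] at h ⊢
  rcases le_total (f (insert u A)) c with hA | hA
  · rw [min_eq_left hA, min_eq_left (h3.trans hA)]
    refine le_trans (mul_le_mul_of_nonneg_left ?_ hγ0) h
    rcases le_total (f (insert u B)) c with hB | hB
    · rw [min_eq_left hB, min_eq_left (h2.trans hB)]
    · rw [min_eq_right hB]
      rcases le_total (f B) c with hB' | hB'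
      · rw [min_eq_left hB']; linarith
      · rw [min_eq_right hB']; linarith
  -- Once adding `u` to `A` reaches the level `c`, the truncated function gains at least as much at
  -- `A` as at `B`, since it cannot exceed `c` at `B` either.
  · rw [min_eq_right hA]
    have h4 : min (f A) c ≤ min (f B) c := min_le_min_right c h1
    have h5 : min (f (insert u B)) c ≤ c := min_le_right _ _
    have h6 : min (f B) c ≤ min (f (insert u B)) c := min_le_min_right c h2
    nlinarith

/-- The factor by which `a` elements of the concealed set, among `k`, reduce the distance to the
saturated value. The first `t` of them act like all other elements, each contributing a factor
`1 - γ / k`; from then on each removes the same amount, a `k`-th of the distance left by the first `t`. The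
subtractions are truncated, so the factor stays nonnegative for `a > k + t`. -/
noncomputable def concealedFactor (γ : ℝ) (k t a : ℕ) : ℝ :=
  (1 - γ / k) ^ min a t * ((k - (a - t) : ℕ) / k)

section concealedFactor

variable {γ : ℝ} {k : ℕ} (t : ℕ)

theorem one_sub_div_mem (hγ0 : 0 < γ) (hγ1 : γ ≤ 1) (hk : 0 < k) :
    0 ≤ 1 - γ / k ∧ 1 - γ / k ≤ 1 := by
  have h : γ / k ≤ 1 := div_le_one_of_le₀ (hγ1.trans (by exact_mod_cast hk)) (by positivity)
  have h' : 0 ≤ γ / k := by positivity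
  constructor <;> linarith

theorem concealedFactor_of_le (hk : 0 < k) {a : ℕ} (ha : a ≤ t) :
    concealedFactor γ k t a = (1 - γ / k) ^ a := by
  have : (k : ℝ) ≠ 0 := by positivity
  simp [concealedFactor, Nat.sub_eq_zero_of_le ha, min_eq_left ha, this]

theorem concealedFactor_nonneg (hγ0 : 0 < γ) (hγ1 : γ ≤ 1) (hk : 0 < k) (a : ℕ) :
    0 ≤ concealedFactor γ k t a :=
  mul_nonneg (pow_nonneg (one_sub_div_mem hγ0 hγ1 hk).1 _) (by positivity)

theorem concealedFactor_antitone (hγ0 : 0 < γ) (hγ1 : γ ≤ 1) (hk : 0 < k) :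
    Antitone (concealedFactor γ k t) := by
  intro a b hab
  have hq := one_sub_div_mem hγ0 hγ1 hk
  refine mul_le_mul (pow_le_pow_of_le_one hq.1 hq.2 (min_le_min_right t hab)) ?_ (by positivity)
    (pow_nonneg hq.1 _)
  have : k - (b - t) ≤ k - (a - t) := by omega
  gcongr

theorem concealedFactor_le_one (hγ0 : 0 < γ) (hγ1 : γ ≤ 1) (hk : 0 < k) (a : ℕ) :
    concealedFactor γ k t a ≤ 1 := by
  have h := concealedFactor_antitone t hγ0 hγ1 hk (Nat.zero_le a)
  rwa [concealedFactor_of_le t hk (Nat.zero_le t), pow_zero] at h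

theorem concealedFactor_sub_of_lt (hk : 0 < k) {a : ℕ} (ha : a < t) :
    concealedFactor γ k t a - concealedFactor γ k t (a + 1) = γ * ((1 - γ / k) ^ a / k) := by
  rw [concealedFactor_of_le t hk ha.le, concealedFactor_of_le t hk ha, pow_succ]
  ring

theorem concealedFactor_sub_of_le {a : ℕ} (ha : t ≤ a) :
    concealedFactor γ k t a - concealedFactor γ k t (a + 1)
      = if a - t < k then (1 - γ / k) ^ t / k else 0 := by
  rw [concealedFactor, concealedFactor, min_eq_right ha, min_eq_right (ha.trans a.le_succ)]
  split_ifs with h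
  · have e : k - (a - t) = (k - (a + 1 - t)) + 1 := by omega
    rw [e]
    push_cast
    ring
  · have e : k - (a - t) = 0 := by omega
    have e' : k - (a + 1 - t) = 0 := by omega
    simp [e, e']

/-- The drop of the factor may grow along the way, but only by a factor `1 / γ`. -/
theorem mul_concealedFactor_sub_le (hγ0 : 0 < γ) (hγ1 : γ ≤ 1) (hk : 0 < k) {a b : ℕ}
    (hab : a ≤ b) :
    γ * (concealedFactor γ k t b - concealedFactor γ k t (b + 1))
      ≤ concealedFactor γ k t a - concealedFactor γ k t (a + 1) := by
  obtain ⟨hq0, hq1⟩ := one_sub_div_mem hγ0 hγ1 hk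
  have hpow : ∀ i j : ℕ, i ≤ j → (1 - γ / k) ^ j / k ≤ (1 - γ / k) ^ i / k := fun i j hij =>
    div_le_div_of_nonneg_right (pow_le_pow_of_le_one hq0 hq1 hij) (by positivity)
  have hnn : ∀ i : ℕ, 0 ≤ (1 - γ / k) ^ i / k := fun i => div_nonneg (pow_nonneg hq0 i)
    (by positivity)
  rcases lt_or_ge b t with hb | hb
  · rw [concealedFactor_sub_of_lt t hk hb, concealedFactor_sub_of_lt t hk (hab.trans_lt hb)]
    refine mul_le_mul_of_nonneg_left ?_ hγ0.le
    exact (mul_le_of_le_one_left (hnn b) hγ1).trans (hpow a b hab)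
  · rw [concealedFactor_sub_of_le t hb]
    rcases lt_or_ge a t with ha | ha
    · rw [concealedFactor_sub_of_lt t hk ha]
      refine mul_le_mul_of_nonneg_left ?_ hγ0.le
      split_ifs
      · exact hpow a t ha.le
      · exact hnn a
    · rw [concealedFactor_sub_of_le t ha]
      split_ifs with h1 h2
      · exact mul_le_of_le_one_left (hnn t) hγ1
      · omega
      · simpa using hnn t
      · simp

end concealedFactor

/-- The distance of a set `S` to the saturated value `1` in the objective that conceals `T`. -/
noncomputable def concealedGap {V : Type*} [DecidableEq V] (γ : ℝ) (k t : ℕ) (T S : Finset V) :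
    ℝ :=
  concealedFactor γ k t (S ∩ T).card * (1 - γ / k) ^ (S \ T).card

/-- The objective that conceals `T`, truncated at the level `1 - η`. With at most `t` elements of
`T`, or with sufficiently many elements, a set does not reveal anything about `T`. -/
noncomputable def concealingObjective {V : Type*} [DecidableEq V] (γ η : ℝ) (k t : ℕ)
    (T S : Finset V) : ℝ :=
  min (1 - concealedGap γ k t T S) (1 - η)

section concealingObjective

variable {V : Type*} [DecidableEq V] {γ η : ℝ} {k : ℕ} (t : ℕ)

theorem concealedGap_antitone (hγ0 : 0 < γ) (hγ1 : γ ≤ 1) (hk : 0 < k) (T : Finset V) :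
    Antitone (concealedGap γ k t T) := by
  intro A B hAB
  have hq := one_sub_div_mem hγ0 hγ1 hk
  exact mul_le_mul
    (concealedFactor_antitone t hγ0 hγ1 hk
      (Finset.card_le_card (Finset.inter_subset_inter_right hAB)))
    (pow_le_pow_of_le_one hq.1 hq.2 (Finset.card_le_card (Finset.sdiff_subset_sdiff hAB subset_rfl)))
    (pow_nonneg hq.1 _) (concealedFactor_nonneg t hγ0 hγ1 hk _)

theorem concealedGap_le_one (hγ0 : 0 < γ) (hγ1 : γ ≤ 1) (hk : 0 < k) (T S : Finset V) :
    concealedGap γ k t T S ≤ 1 := by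
  have hq := one_sub_div_mem hγ0 hγ1 hk
  exact mul_le_one₀ (concealedFactor_le_one t hγ0 hγ1 hk _) (pow_nonneg hq.1 _)
    (pow_le_one₀ hq.1 hq.2)

theorem concealedGap_of_card_inter_le (hk : 0 < k) {T S : Finset V} (h : (S ∩ T).card ≤ t) :
    concealedGap γ k t T S = (1 - γ / k) ^ S.card := by
  rw [concealedGap, concealedFactor_of_le t hk h, ← pow_add, Finset.card_inter_add_card_sdiff]

/-- An element of `T` multiplies a drop of the factor, an element outside of `T` the factor itself,
by a power of `1 - γ / k`; both kinds of drops satisfy the weak diminishing returns inequality. -/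
theorem isWeaklyDR_one_sub_concealedGap (hγ0 : 0 < γ) (hγ1 : γ ≤ 1) (hk : 0 < k)
    (T : Finset V) : IsWeaklyDR γ fun S => 1 - concealedGap γ k t T S := by
  intro A B hAB u hu
  obtain ⟨hq0, hq1⟩ := one_sub_div_mem hγ0 hγ1 hk
  have huA : u ∉ A := fun h => hu (hAB h)
  have ha : (A ∩ T).card ≤ (B ∩ T).card :=
    Finset.card_le_card (Finset.inter_subset_inter_right hAB)
  have hb : (A \ T).card ≤ (B \ T).card :=
    Finset.card_le_card (Finset.sdiff_subset_sdiff hAB subset_rfl)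
  have hp : (1 - γ / k) ^ (B \ T).card ≤ (1 - γ / k) ^ (A \ T).card :=
    pow_le_pow_of_le_one hq0 hq1 hb
  have hpB : 0 ≤ (1 - γ / k) ^ (B \ T).card := pow_nonneg hq0 _
  have hpA : 0 ≤ (1 - γ / k) ^ (A \ T).card := pow_nonneg hq0 _
  simp only [marginalGain, ge_iff_le, concealedGap]
  by_cases huT : u ∈ T
  · have e : ∀ S : Finset V, u ∉ S → (insert u S ∩ T).card = (S ∩ T).card + 1 ∧
        (insert u S \ T).card = (S \ T).card := by
      intro S hS
      rw [Finset.insert_inter_of_mem huT, Finset.insert_sdiff_of_mem _ huT]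
      exact ⟨Finset.card_insert_of_notMem (by simp [hS]), rfl⟩
    rw [(e A huA).1, (e A huA).2, (e B hu).1, (e B hu).2]
    have h := mul_concealedFactor_sub_le t hγ0 hγ1 hk ha
    have h0 : 0 ≤ concealedFactor γ k t (A ∩ T).card - concealedFactor γ k t ((A ∩ T).card + 1) :=
      sub_nonneg.2 (concealedFactor_antitone t hγ0 hγ1 hk (Nat.le_succ _))
    have := mul_le_mul h hp hpB h0
    linarith
  · have e : ∀ S : Finset V, u ∉ S → (insert u S ∩ T).card = (S ∩ T).card ∧
        (insert u S \ T).card = (S \ T).card + 1 := by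
      intro S hS
      rw [Finset.insert_inter_of_notMem huT, Finset.insert_sdiff_of_notMem _ huT]
      exact ⟨rfl, Finset.card_insert_of_notMem (by simp [hS])⟩
    rw [(e A huA).1, (e A huA).2, (e B hu).1, (e B hu).2, pow_succ, pow_succ]
    have h1 := mul_le_mul (concealedFactor_antitone t hγ0 hγ1 hk ha) hp hpB
      (concealedFactor_nonneg t hγ0 hγ1 hk _)
    have h2 := mul_nonneg (concealedFactor_nonneg t hγ0 hγ1 hk (B ∩ T).card) hpB
    have h3 := (mul_le_of_le_one_left h2 hγ1).trans h1
    have h4 := mul_le_mul_of_nonneg_right h3 (sub_nonneg.2 hq1)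
    linarith

theorem concealingObjective_mem {n : ℕ} (hγ0 : 0 < γ) (hγ1 : γ ≤ 1) (hη : η ≤ 1) (hk : 0 < k)
    (T : Finset (Fin n)) : concealingObjective γ η k t T ∈ weaklyDRClass γ n := by
  have hm : Monotone fun S => 1 - concealedGap γ k t T S := fun A B hAB =>
    sub_le_sub_left (concealedGap_antitone t hγ0 hγ1 hk T hAB) 1
  refine ⟨fun S => le_min ?_ (sub_nonneg.2 hη), fun A B hAB => min_le_min_right _ (hm hAB), ?_⟩
  · exact sub_nonneg.2 (concealedGap_le_one t hγ0 hγ1 hk T S)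
  · exact (isWeaklyDR_one_sub_concealedGap t hγ0 hγ1 hk T).min_const hγ0.le hγ1 hm _

theorem concealingObjective_of_card_inter_le (hk : 0 < k) {T S : Finset V}
    (h : (S ∩ T).card ≤ t) :
    concealingObjective γ η k t T S = min (1 - (1 - γ / k) ^ S.card) (1 - η) := by
  rw [concealingObjective, concealedGap_of_card_inter_le t hk h]

theorem concealingObjective_of_saturated (hγ0 : 0 < γ) (hγ1 : γ ≤ 1) (hk : 0 < k) {l : ℕ}
    (hl : (1 - γ / k) ^ (l * k) ≤ η) {T S : Finset V} (hT : T.card ≤ k)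
    (hS : (l + 1) * k ≤ S.card) : concealingObjective γ η k t T S = 1 - η := by
  obtain ⟨hq0, hq1⟩ := one_sub_div_mem hγ0 hγ1 hk
  have h1 : l * k ≤ (S \ T).card := by
    have := Finset.le_card_sdiff T S
    rw [Nat.succ_mul] at hS
    omega
  refine min_eq_right (sub_le_sub_left ?_ 1)
  calc concealedGap γ k t T S
      ≤ 1 * (1 - γ / k) ^ (S \ T).card :=
        mul_le_mul_of_nonneg_right (concealedFactor_le_one t hγ0 hγ1 hk _) (pow_nonneg hq0 _)
    _ ≤ (1 - γ / k) ^ (l * k) := by rw [one_mul]; exact pow_le_pow_of_le_one hq0 hq1 h1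
    _ ≤ η := hl

theorem concealingObjective_self (hγ0 : 0 < γ) (hγ1 : γ ≤ 1) (hk : 0 < k) (htk : t ≤ k)
    (hη : (t : ℝ) / k ≤ η) {T : Finset V} (hT : T.card = k) :
    concealingObjective γ η k t T T = 1 - η := by
  obtain ⟨hq0, hq1⟩ := one_sub_div_mem hγ0 hγ1 hk
  refine min_eq_right (sub_le_sub_left ?_ 1)
  have e : k - (k - t) = t := by omega
  rw [concealedGap, Finset.inter_self, sdiff_self, Finset.bot_eq_empty, Finset.card_empty, pow_zero,
    mul_one, hT, concealedFactor, e]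
  exact (mul_le_of_le_one_left (by positivity) (pow_le_one₀ hq0 hq1)).trans hη

end concealingObjective

/-! ### Random transversals -/

/-- The graph of `φ : Fin k → Fin m`, as a subset of `Fin (k * m)`. -/
def transversal {k m : ℕ} (φ : Fin k → Fin m) : Finset (Fin (k * m)) :=
  Finset.univ.image fun i => finProdFinEquiv (i, φ i)

theorem transversal_injective {k m : ℕ} (φ : Fin k → Fin m) :
    Function.Injective fun i => finProdFinEquiv (i, φ i) := fun i j h => by
  have := finProdFinEquiv.injective h
  exact (Prod.mk.inj this).1

theorem card_transversal {k m : ℕ} (φ : Fin k → Fin m) : (transversal φ).card = k := by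
  rw [transversal, Finset.card_image_of_injective _ (transversal_injective φ), Finset.card_fin]

theorem pow_card_inter_transversal {k m : ℕ} (φ : Fin k → Fin m) (S : Finset (Fin (k * m)))
    (z : ℝ) :
    z ^ (S ∩ transversal φ).card = ∏ i, if finProdFinEquiv (i, φ i) ∈ S then z else 1 := by
  have h : S ∩ transversal φ = (Finset.univ.filter fun i => finProdFinEquiv (i, φ i) ∈ S).image
      fun i => finProdFinEquiv (i, φ i) := by
    ext x
    simp only [transversal, Finset.mem_inter, Finset.mem_image, Finset.mem_univ, true_and,
      Finset.mem_filter]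
    constructor
    · rintro ⟨hx, i, rfl⟩
      exact ⟨i, hx, rfl⟩
    · rintro ⟨i, hx, rfl⟩
      exact ⟨hx, i, rfl⟩
  rw [h, Finset.card_image_of_injective _ (transversal_injective φ), Finset.prod_ite,
    Finset.prod_const, Finset.prod_const_one, mul_one]

/-- The generating function of the size of the intersection of `S` with a random transversal: the
blocks are independent, so it is a product over the blocks. -/
theorem sum_pow_card_inter_transversal_le {k m : ℕ} (hm : 0 < m) (S : Finset (Fin (k * m))) {z : ℝ}
    (hz : 0 ≤ z) :
    ∑ φ : Fin k → Fin m, z ^ (S ∩ transversal φ).card ≤ m ^ k * Real.exp (z * S.card / m) := by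
  have hm' : (0 : ℝ) < m := by exact_mod_cast hm
  set s : Fin k → ℝ := fun i =>
    ((Finset.univ.filter fun j : Fin m => finProdFinEquiv (i, j) ∈ S).card : ℝ) with hs
  have hsum : ∑ i, s i = S.card := by
    rw [hs, ← Nat.cast_sum]
    congr 1
    rw [← Finset.card_sigma]
    refine Finset.card_bij (fun x _ => finProdFinEquiv (x.1, x.2)) ?_ ?_ ?_
    · rintro ⟨i, j⟩ h
      simpa using h
    · rintro ⟨i, j⟩ _ ⟨i', j'⟩ _ h
      obtain ⟨rfl, rfl⟩ := Prod.mk.inj (finProdFinEquiv.injective h)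
      rfl
    · intro x hx
      refine ⟨⟨(finProdFinEquiv.symm x).1, (finProdFinEquiv.symm x).2⟩, ?_, ?_⟩
      · have e := finProdFinEquiv.apply_symm_apply x
        simp only [Finset.mem_sigma, Finset.mem_univ, true_and, Finset.mem_filter]
        rwa [Prod.mk.eta, e]
      · exact finProdFinEquiv.apply_symm_apply x
  calc ∑ φ : Fin k → Fin m, z ^ (S ∩ transversal φ).card
      = ∏ i : Fin k, ∑ j : Fin m, if finProdFinEquiv (i, j) ∈ S then z else 1 := by
        rw [Finset.prod_univ_sum, Fintype.piFinset_univ]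
        exact Finset.sum_congr rfl fun φ _ => pow_card_inter_transversal φ S z
    _ ≤ ∏ i : Fin k, (m * Real.exp (z * s i / m)) := by
        refine Finset.prod_le_prod (fun i _ => Finset.sum_nonneg fun j _ => ?_) fun i _ => ?_
        · split_ifs <;> linarith
        calc ∑ j : Fin m, (if finProdFinEquiv (i, j) ∈ S then z else 1)
            ≤ ∑ j : Fin m, ((if finProdFinEquiv (i, j) ∈ S then z else 0) + 1) := by
              refine Finset.sum_le_sum fun j _ => ?_
              split_ifs <;> linarith
          _ = s i * z + m := by
              rw [Finset.sum_add_distrib, ← Finset.sum_filter, Finset.sum_const, nsmul_eq_mul]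
              simp [hs]
          _ = m * (z * s i / m + 1) := by field_simp
          _ ≤ m * Real.exp (z * s i / m) :=
              mul_le_mul_of_nonneg_left (Real.add_one_le_exp _) hm'.le
    _ = m ^ k * Real.exp (z * S.card / m) := by
        rw [Finset.prod_mul_distrib, Finset.prod_const, Finset.card_fin, ← Real.exp_sum,
          ← Finset.sum_div, ← Finset.mul_sum, hsum]

/-- Few transversals meet a given set of `O(k)` elements in more than `t` places. -/
theorem card_filter_lt_card_inter_transversal_le {k : ℕ} (hk : 0 < k) {l : ℕ} (hl : 0 < l)
    (hlk : l ≤ k) (t : ℕ) {S : Finset (Fin (k * k ^ 2))} (hS : S.card ≤ l * k) :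
    (((Finset.univ : Finset (Fin k → Fin (k ^ 2))).filter
      fun φ => t < (S ∩ transversal φ).card).card : ℝ)
      ≤ ((k ^ 2 : ℕ) : ℝ) ^ k * (Real.exp 1 * (l / k) ^ (t + 1)) := by
  have hk' : (0 : ℝ) < k := by exact_mod_cast hk
  have hl' : (0 : ℝ) < l := by exact_mod_cast hl
  -- With this base, the exponent in the bound on the generating function is at most `1`.
  set z : ℝ := k / l with hz
  have hz0 : 0 < z := by positivity
  have hz1 : 1 ≤ z := by rw [hz, one_le_div hl']; exact_mod_cast hlk
  set F := (Finset.univ : Finset (Fin k → Fin (k ^ 2))).filter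
      fun φ => t < (S ∩ transversal φ).card with hF
  have h1 : (F.card : ℝ) * z ^ (t + 1) ≤ ((k ^ 2 : ℕ) : ℝ) ^ k * Real.exp 1 := by
    calc (F.card : ℝ) * z ^ (t + 1) = ∑ _φ ∈ F, z ^ (t + 1) := by
          rw [Finset.sum_const, nsmul_eq_mul]
      _ ≤ ∑ φ ∈ F, z ^ (S ∩ transversal φ).card :=
          Finset.sum_le_sum fun φ hφ => pow_le_pow_right₀ hz1 (Finset.mem_filter.1 hφ).2
      _ ≤ ∑ φ : Fin k → Fin (k ^ 2), z ^ (S ∩ transversal φ).card :=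
          Finset.sum_le_sum_of_subset_of_nonneg (Finset.filter_subset _ _)
            fun _ _ _ => by positivity
      _ ≤ _ := sum_pow_card_inter_transversal_le (by positivity) S hz0.le
      _ ≤ _ := by
          refine mul_le_mul_of_nonneg_left (Real.exp_le_exp.2 ?_) (by positivity)
          have hS' : (S.card : ℝ) ≤ l * k := by exact_mod_cast hS
          rw [div_le_one (by positivity), hz]
          push_cast
          calc (k : ℝ) / l * S.card ≤ k / l * (l * k) :=
                mul_le_mul_of_nonneg_left hS' (by positivity)
            _ = k ^ 2 := by field_simp
  have e : (l / k : ℝ) = z⁻¹ := by rw [hz, inv_div]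
  rw [e, inv_pow, ← mul_assoc, ← div_eq_mul_inv, le_div_iff₀ (by positivity)]
  exact h1

/-! ### Hardness -/

/-- An algorithm cannot tell apart two objectives that agree on the sets it evaluates. -/
theorem OracleAlgorithm.exists_queried {V : Type} [DecidableEq V] (g : Finset V → ℝ)
    (a : OracleAlgorithm V) :
    ∃ Q : Finset (Finset V), Q.card ≤ a.queries g ∧
      ∀ f : Finset V → ℝ, (∀ S ∈ Q, f S = g S) → a.result f = a.result g := by
  induction a with
  | output S => exact ⟨∅, by simp, fun f _ => rfl⟩
  | query S next ih =>
    obtain ⟨Q, hQ, h⟩ := ih (g S)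
    refine ⟨insert S Q, (Finset.card_insert_le _ _).trans (Nat.succ_le_succ hQ), fun f hf => ?_⟩
    have hS : f S = g S := hf S (Finset.mem_insert_self _ _)
    simp only [OracleAlgorithm.result, hS]
    exact h f fun S' hS' => hf S' (Finset.mem_insert_of_mem hS')

theorem RandomizedAlgorithm.integrable_comp_result (A : RandomizedAlgorithm.{u}) (n k : ℕ)
    (f h : Finset (Fin n) → ℝ) : Integrable (fun ω => h ((A.run n k ω).result f)) A.law := by
  have e : (fun ω => h ((A.run n k ω).result f)) = fun ω => ∑ S : Finset (Fin n),
      Set.indicator {ω | (A.run n k ω).result f = S} (fun _ => h S) ω := by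
    funext ω
    rw [Finset.sum_eq_single ((A.run n k ω).result f)]
    · simp
    · intro S _ hS
      exact Set.indicator_of_notMem (fun h => hS h.symm) _
    · simp
  rw [e]
  exact integrable_finsetSum _ fun S _ =>
    (integrable_const _).indicator (A.measurableSet_result n k f S)

/-- An algorithm that makes few queries has the same output, which is poor, for most of the concealed
transversals. -/
theorem sum_concealingObjective_result_le {γ η : ℝ} (hγ0 : 0 < γ) (hγ1 : γ ≤ 1) (hη0 : 0 ≤ η)
    {k l t N : ℕ} (hk : 0 < k) (hlk : l + 1 ≤ k) (hl : (1 - γ / k) ^ (l * k) ≤ η)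
    (a : OracleAlgorithm (Fin (k * k ^ 2)))
    (hN : a.queries (concealingObjective γ η k t ∅) ≤ N)
    (hR : (a.result (concealingObjective γ η k t ∅)).card ≤ k) :
    ∑ φ : Fin k → Fin (k ^ 2), concealingObjective γ η k t (transversal φ)
        (a.result (concealingObjective γ η k t (transversal φ)))
      ≤ ((k ^ 2 : ℕ) : ℝ) ^ k *
        (1 - (1 - γ / k) ^ k + (N + 1) * (Real.exp 1 * ((l + 1 : ℕ) / k) ^ (t + 1))) := by
  obtain ⟨hq0, hq1⟩ := one_sub_div_mem hγ0 hγ1 hk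
  set g := concealingObjective γ η k t (∅ : Finset (Fin (k * k ^ 2))) with hg
  set R := a.result g with hRdef
  obtain ⟨Q, hQ, hagree⟩ := a.exists_queried g
  -- The sets whose intersection with the concealed transversal matters: the output, and the queries
  -- below the saturation size.
  set P := insert R (Q.filter fun S => S.card ≤ (l + 1) * k) with hP
  have hPcard : (P.card : ℝ) ≤ N + 1 := by
    have : P.card ≤ N + 1 := (Finset.card_insert_le _ _).trans
      (Nat.succ_le_succ ((Finset.card_filter_le _ _).trans (hQ.trans hN)))
    exact_mod_cast this
  set bad : Finset (Fin (k * k ^ 2)) → Finset (Fin k → Fin (k ^ 2)) := fun S =>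
    Finset.univ.filter fun φ => t < (S ∩ transversal φ).card with hbad
  have hbadcard : ((P.biUnion bad).card : ℝ)
      ≤ (N + 1) * (((k ^ 2 : ℕ) : ℝ) ^ k * (Real.exp 1 * ((l + 1 : ℕ) / k) ^ (t + 1))) := by
    calc ((P.biUnion bad).card : ℝ) ≤ ((∑ S ∈ P, (bad S).card : ℕ) : ℝ) := by
          exact_mod_cast Finset.card_biUnion_le
      _ = ∑ S ∈ P, ((bad S).card : ℝ) := by push_cast; rfl
      _ ≤ ∑ _S ∈ P, (((k ^ 2 : ℕ) : ℝ) ^ k * (Real.exp 1 * ((l + 1 : ℕ) / k) ^ (t + 1))) := by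
          refine Finset.sum_le_sum fun S hS => ?_
          refine card_filter_lt_card_inter_transversal_le hk l.succ_pos hlk t ?_
          rcases Finset.mem_insert.1 hS with rfl | h
          · exact hR.trans (Nat.le_mul_of_pos_left k l.succ_pos)
          · exact (Finset.mem_filter.1 h).2
      _ ≤ _ := by
          rw [Finset.sum_const, nsmul_eq_mul]
          exact mul_le_mul_of_nonneg_right hPcard (by positivity)
  have hpoint : ∀ φ : Fin k → Fin (k ^ 2), concealingObjective γ η k t (transversal φ)
        (a.result (concealingObjective γ η k t (transversal φ)))
      ≤ (1 - (1 - γ / k) ^ k) + if φ ∈ P.biUnion bad then 1 else 0 := by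
    intro φ
    split_ifs with hφ
    · have h1 : (1 - γ / k) ^ k ≤ 1 := pow_le_one₀ hq0 hq1
      have h2 : concealingObjective γ η k t (transversal φ)
        (a.result (concealingObjective γ η k t (transversal φ))) ≤ 1 - η := min_le_right _ _
      linarith
    · have hgood : ∀ S ∈ P, (S ∩ transversal φ).card ≤ t := by
        intro S hS
        by_contra hlt
        exact hφ (Finset.mem_biUnion.2 ⟨S, hS, by simpa [hbad] using hlt⟩)
      have hsame : a.result (concealingObjective γ η k t (transversal φ)) = R := by
        refine hagree _ fun S hS => ?_
        rcases le_total S.card ((l + 1) * k) with h | h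
        · rw [concealingObjective_of_card_inter_le t hk (hgood S (Finset.mem_insert_of_mem
            (Finset.mem_filter.2 ⟨hS, h⟩))), hg,
            concealingObjective_of_card_inter_le t hk (by simp)]
        · rw [concealingObjective_of_saturated t hγ0 hγ1 hk hl (card_transversal φ).le h, hg,
            concealingObjective_of_saturated t hγ0 hγ1 hk hl (by simp) h]
      rw [hsame, concealingObjective_of_card_inter_le t hk (hgood R (Finset.mem_insert_self _ _)),
        add_zero]
      exact (min_le_left _ _).trans (sub_le_sub_left (pow_le_pow_of_le_one hq0 hq1 hR) 1)
  refine (Finset.sum_le_sum fun φ _ => hpoint φ).trans ?_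
  rw [Finset.sum_add_distrib, Finset.sum_const, Finset.sum_ite_mem, Finset.univ_inter,
    Finset.sum_const, nsmul_eq_mul, nsmul_eq_mul, mul_one, Finset.card_univ, Fintype.card_fun,
    Fintype.card_fin, Fintype.card_fin]
  push_cast at hbadcard ⊢
  linarith

/-- The ratio achieved within a given number of queries on the instances with `n = k ^ 3`. -/
theorem mul_le_of_isApproximation {γ η ρ : ℝ} (hγ0 : 0 < γ) (hγ1 : γ ≤ 1) (hη0 : 0 ≤ η)
    (hη1 : η ≤ 1) {k l t N : ℕ} (hk : 0 < k) (hlk : l + 1 ≤ k)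
    (hl : (1 - γ / k) ^ (l * k) ≤ η) (htk : t ≤ k) (ht : (t : ℝ) / k ≤ η)
    (A : RandomizedAlgorithm.{u}) (hA : A.IsApproximation (weaklyDRClass γ) ρ)
    (hN : ∀ f ∈ weaklyDRClass γ (k * k ^ 2), ∀ ω, (A.run (k * k ^ 2) k ω).queries f ≤ N) :
    ρ * (1 - η) ≤
      1 - (1 - γ / k) ^ k + (N + 1) * (Real.exp 1 * ((l + 1 : ℕ) / k) ^ (t + 1)) := by
  set β := 1 - (1 - γ / k) ^ k + (N + 1) * (Real.exp 1 * ((l + 1 : ℕ) / k) ^ (t + 1)) with hβ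
  set f : (Fin k → Fin (k ^ 2)) → Finset (Fin (k * k ^ 2)) → ℝ :=
    fun φ => concealingObjective γ η k t (transversal φ) with hf
  have hmem : ∀ T : Finset (Fin (k * k ^ 2)),
      concealingObjective γ η k t T ∈ weaklyDRClass γ (k * k ^ 2) :=
    concealingObjective_mem t hγ0 hγ1 hη1 hk
  have hlow : ∀ φ, ρ * (1 - η) ≤
      ∫ ω, f φ ((A.run (k * k ^ 2) k ω).result (f φ)) ∂A.law := by
    intro φ
    have h := (hA _ k (f φ) (hmem _)).2 (transversal φ) (card_transversal φ).le
    simp only [hf] at h ⊢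
    rwa [concealingObjective_self t hγ0 hγ1 hk htk ht (card_transversal φ)] at h
  have hup : ∑ φ, ∫ ω, f φ ((A.run (k * k ^ 2) k ω).result (f φ)) ∂A.law
      ≤ ((k ^ 2 : ℕ) : ℝ) ^ k * β := by
    rw [← integral_finsetSum _ fun φ _ => A.integrable_comp_result _ k (f φ) (f φ)]
    have hint : Integrable (fun ω => ∑ φ, f φ ((A.run (k * k ^ 2) k ω).result (f φ))) A.law :=
      integrable_finsetSum _ fun φ _ => A.integrable_comp_result _ k (f φ) (f φ)
    refine (integral_mono hint (integrable_const (((k ^ 2 : ℕ) : ℝ) ^ k * β)) fun ω => ?_).trans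
      (by simp)
    exact sum_concealingObjective_result_le hγ0 hγ1 hη0 hk hlk hl _ (hN _ (hmem ∅) ω)
      ((hA _ k _ (hmem ∅)).1 ω)
  have hsum := Finset.sum_le_sum fun φ (_ : φ ∈ Finset.univ) => hlow φ
  rw [Finset.sum_const, nsmul_eq_mul, Finset.card_univ, Fintype.card_fun, Fintype.card_fin,
    Fintype.card_fin] at hsum
  have hpos : (0 : ℝ) < ((k ^ 2 : ℕ) : ℝ) ^ k := by positivity
  push_cast at hsum hup hpos
  exact le_of_mul_le_mul_left (hsum.trans hup) hpos

theorem Polynomial.eval_nat_le (p : Polynomial ℕ) {x : ℕ} (hx : 0 < x) :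
    p.eval x ≤ p.eval 1 * x ^ p.natDegree := by
  rw [Polynomial.eval_eq_sum_range, Polynomial.eval_eq_sum_range, Finset.sum_mul]
  refine Finset.sum_le_sum fun i hi => ?_
  rw [one_pow, mul_one]
  exact Nat.mul_le_mul_left _ (Nat.pow_le_pow_right hx (Nat.lt_succ_iff.1 (Finset.mem_range.1 hi)))

open Filter Topology in
/-- With `t` at least the degree of the number of queries in `k`, the failure probability tends to
`0` as `k` tends to infinity. -/
theorem mul_one_sub_le_of_hasApproximation {γ η ρ : ℝ} (hγ0 : 0 < γ) (hγ1 : γ ≤ 1) (hη0 : 0 < η)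
    (hη1 : η ≤ 1) (h : HasPolynomialTimeApproximation.{u} (weaklyDRClass γ) ρ) :
    ρ * (1 - η) ≤ 1 - Real.exp (-γ) := by
  obtain ⟨A, ⟨p, hp⟩, hA⟩ := h
  set P : Polynomial ℕ := p.comp (Polynomial.X * Polynomial.X ^ 2) + 1 with hP
  set t := P.natDegree with ht
  have hPeval : ∀ k : ℕ, p.eval (k * k ^ 2) + 1 = P.eval k := fun k => by
    simp [hP, Polynomial.eval_comp]
  obtain ⟨l, hl⟩ : ∃ l : ℕ, Real.exp (-γ * l) ≤ η := by
    obtain ⟨l, hl⟩ := exists_nat_ge (-Real.log η / γ)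
    refine ⟨l, ?_⟩
    rw [div_le_iff₀ hγ0] at hl
    rw [← Real.le_log_iff_exp_le hη0]
    linarith
  set c : ℝ := P.eval 1 * Real.exp 1 * ((l + 1 : ℕ) : ℝ) ^ (t + 1) with hc
  have hlim : Tendsto (fun k : ℕ => 1 - (1 - γ / k : ℝ) ^ k + c / k) atTop
      (𝓝 (1 - Real.exp (-γ) + 0)) := by
    refine Tendsto.add (Tendsto.sub tendsto_const_nhds ?_) (tendsto_const_div_atTop_nhds_zero_nat c)
    have := Real.tendsto_one_add_div_pow_exp (-γ)
    refine this.congr fun k => ?_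
    rw [neg_div, ← sub_eq_add_neg]
  rw [add_zero] at hlim
  have hsmall : ∀ᶠ k : ℕ in atTop, (t : ℝ) / k ≤ η :=
    (tendsto_const_div_atTop_nhds_zero_nat (t : ℝ)).eventually_le_const hη0
  refine ge_of_tendsto hlim ?_
  filter_upwards [hsmall, eventually_ge_atTop (l + 1), eventually_ge_atTop t] with k hk1 hk2 hk3
  have hk : 0 < k := by omega
  have hk' : (0 : ℝ) < k := by exact_mod_cast hk
  obtain ⟨hq0, hq1⟩ := one_sub_div_mem hγ0 hγ1 hk
  have hlk : (1 - γ / k) ^ (l * k) ≤ η := by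
    refine le_trans ?_ hl
    rw [mul_comm l k, pow_mul, mul_comm, Real.exp_nat_mul]
    exact pow_le_pow_left₀ (pow_nonneg hq0 k)
      (Real.one_sub_div_pow_le_exp_neg (hγ1.trans (by exact_mod_cast hk))) l
  refine (mul_le_of_isApproximation hγ0 hγ1 hη0.le hη1 hk hk2 hlk hk3 hk1 A hA
    (hp (k * k ^ 2) k)).trans ?_
  gcongr
  have h1 : ((p.eval (k * k ^ 2) : ℕ) + 1 : ℝ) ≤ P.eval 1 * (k : ℝ) ^ t := by
    have := P.eval_nat_le hk
    rw [← hPeval k] at this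
    exact_mod_cast this
  calc ((p.eval (k * k ^ 2) : ℕ) + 1 : ℝ) * (Real.exp 1 * ((l + 1 : ℕ) / k) ^ (t + 1))
      ≤ (P.eval 1 * (k : ℝ) ^ t) * (Real.exp 1 * ((l + 1 : ℕ) / k) ^ (t + 1)) :=
        mul_le_mul_of_nonneg_right h1 (by positivity)
    _ = c / k := by
        rw [hc, div_pow, pow_succ (k : ℝ) t]
        field_simp

/-- As the truncation parameter `η` tends to `0`: no polynomial-time ratio exceeds `1 - e ^ (-γ)`. -/
theorem le_one_sub_exp_of_hasApproximation {γ ρ : ℝ} (hγ0 : 0 < γ) (hγ1 : γ ≤ 1)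
    (h : HasPolynomialTimeApproximation.{u} (weaklyDRClass γ) ρ) : ρ ≤ 1 - Real.exp (-γ) := by
  have hlim : Filter.Tendsto (fun η : ℝ => ρ * (1 - η)) (nhdsWithin 0 (Set.Ioi 0)) (nhds ρ) := by
    have hc : Continuous fun η : ℝ => ρ * (1 - η) := by fun_prop
    have := (hc.tendsto 0).mono_left (nhdsWithin_le_nhds (s := Set.Ioi 0))
    simpa using this
  refine le_of_tendsto hlim ?_
  filter_upwards [Ioc_mem_nhdsGT (zero_lt_one' ℝ)] with η hη
  exact mul_one_sub_le_of_hasApproximation hγ0 hγ1 hη.1 hη.2 h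

theorem mainTheorem5 (γ : ℝ) (hγ0 : 0 < γ) (hγ1 : γ ≤ 1) :
    (∀ ε : ℝ, 0 < ε →
      ¬ HasPolynomialTimeApproximation.{u} (weaklyDRClass γ) (1 - Real.exp (-γ) + ε) ∧
      ¬ HasPolynomialTimeApproximation.{u} (weaklySubmodularClass γ) (1 - Real.exp (-γ) + ε)) ∧
    HasPolynomialTimeApproximation.{u} (weaklyDRClass γ) (1 - Real.exp (-γ)) ∧
    HasPolynomialTimeApproximation.{u} (weaklySubmodularClass γ) (1 - Real.exp (-γ)) := by
  have hgreedy : HasPolynomialTimeApproximation.{u} (weaklySubmodularClass γ)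
      (1 - Real.exp (-γ)) :=
    ⟨greedyAlgorithm, greedyAlgorithm_isPolynomialTime _,
      greedyAlgorithm_isApproximation hγ0 hγ1⟩
  have hhard : ∀ ε : ℝ, 0 < ε →
      ¬ HasPolynomialTimeApproximation.{u} (weaklyDRClass γ) (1 - Real.exp (-γ) + ε) :=
    fun ε hε h => by linarith [le_one_sub_exp_of_hasApproximation hγ0 hγ1 h]
  exact ⟨fun ε hε => ⟨hhard ε hε, fun h => hhard ε hε (h.mono (weaklyDRClass_subset γ))⟩,
    hgreedy.mono (weaklyDRClass_subset γ), hgreedy⟩
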